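/- Let $N$ (agents) and $M$ (items) be finite sets. For each $i\in N$ let $v_i:2^M\to\mathbb R_{\ge 0}$ be monotone and submodular with $v_i(\emptyset)=0$; write $v_i(j)=v_i(\{j\})$. Let $(y_{i,S})_{i\in N,S\subseteq M}$ be a feasible solution of the configuration LP, i.e. $y_{i,S}\ge 0$, $\sum_{S}y_{i,S}=1$ for every $i\in N$, and $\sum_{S\ni j}\sum_{i}y_{i,S}=1$ for every $j\in M$. A set $S$ with $y_{i,S}>0$ is called a configuration of $i$; assume that all configurations are non-empty, and for each configuration $S$ of $i$ let $\kappa_i(S)\in S$ be an item maximizing $v_i(j)$ over $j\in S$ (ties broken arbitrarily). Multigraph. Agent $i$ and item $j$ are joined by a marked edge of value $x^*=\sum_{S:\kappa_i(S)=j}y_{i,S}$ if $j=\kappa_i(S)$ for some configuration $S$ of $i$, and by an unmarked edge of value $x^*=\sum_{S:j\in S\setminus\{\kappa_i(S)\}}y_{i,S}$ if $j\in S\setminus\{\kappa_i(S)\}$ for some configuration $S$ of $i$ (sums over configurations $S$ of $i$; both edges may be present). Let $E$ be the set of edges. Rounding. Start with $x=x^*\in[0,1]^E$. While some $x_e$ lies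 strictly between $0$ and $1$, choose, arbitrarily, among the edges $e$ with $0<x_e<1$ either a marked cycle (a simple cycle $(i_1,j_1,\dots,i_k,j_k,i_{k+1}=i_1)$ of marked edges) or a pseudo-marked path $(i_1,j_1,\dots,i_k,j_k,i_{k+1})$, $k\ge1$, meaning that $(j_1,i_2,\dots,i_k,j_k)$ is a simple path of marked edges and $i_1j_1$, $j_ki_{k+1}$ are distinct unmarked edges. Put $\delta_1=\min_{a\le k}\min\{x_{i_aj_a},1-x_{j_ai_{a+1}}\}$ and $\delta_2=\min_{a\le k}\min\{1-x_{i_aj_a},x_{j_ai_{a+1}}\}$. With probability $\frac{\delta_2}{\delta_1+\delta_2}$ decrease all $x_{i_aj_a}$ by $\delta_1$ and increase all $x_{j_ai_{a+1}}$ by $\delta_1$; otherwise increase all $x_{i_aj_a}$ by $\delta_2$ and decrease all $x_{j_ai_{a+1}}$ by $\delta_2$. Let $X\in\{0,1\}^E$ be the final vector. Fix an agent $i$ and write $v=v_i$, $\kappa=\kappa_i$, $y_S=y_{i,S}$. Let $T^{\mathrm S}$ be the (random) set of items $j$ whose unmarked edge to $i$ has $X$-value $1$. Sort the configurations of $i$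 in descending order of $v(\kappa(S))$, ties broken arbitrarily. For $t\in[0,1]$ let $\pi_t$ be the first configuration $S$ in this order such that the sum of $y_{S'}$ over all $S'$ up to and including $S$ is at least $t$, and put $u_t=v(\kappa(\pi_t))$ and $B_t=v(\pi_t\setminus\{\kappa(\pi_t)\})$. For $t\in(0,1]$ let $C_t$ be the largest number $A$ with $\Pr[v(T^{\mathrm S})\ge A]\ge t$, and let $C_0=\lim_{t\to0^+}C_t$. Lemma. For every $\lambda\ge 0$, the set of all $t\in[0,1]$ with $\ln B_t>\ln(u_t+C_t)+\lambda$ (where $\ln 0=-\infty$) is measurable, and its Lebesgue measure is at most $(6\lambda+1)e^{-\lambda}$. -/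

import Mathlib

open MeasureTheory Filter Topology

noncomputable section

namespace NashWelfare

/-- A valuation: non-negative, monotone, submodular, with value `0` on the empty set. -/
structure IsValuation {M : Type*} [DecidableEq M] (v : Finset M → ℝ) : Prop where
  nonneg : ∀ S, 0 ≤ v S
  empty : v ∅ = 0
  mono : ∀ S T, S ⊆ T → v S ≤ v T
  submodular : ∀ S T, v (S ∩ T) + v (S ∪ T) ≤ v S + v T

/-- Feasibility for the configuration LP. -/
structure IsConfLPFeasible {N M : Type*} [Fintype N] [Fintype M] [DecidableEq M]
    (y : N → Finset M → ℝ) : Prop where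
  nonneg : ∀ i S, 0 ≤ y i S
  agent : ∀ i, ∑ S : Finset M, y i S = 1
  item : ∀ j, ∑ S : Finset M with j ∈ S, ∑ i : N, y i S = 1

/-- `κ i S` is a most valuable item of `S` for agent `i`, for every configuration `S` of `i`
(a set `S` with `y i S > 0`). Ties are broken arbitrarily. -/
def IsLargestItem {N M : Type*} (v : N → Finset M → ℝ) (y : N → Finset M → ℝ)
    (κ : N → Finset M → M) : Prop :=
  ∀ i S, 0 < y i S → κ i S ∈ S ∧ ∀ j ∈ S, v i {j} ≤ v i {κ i S}

/-- Possible edges of the bipartite multigraph: at most one marked edge (flag `true`) and at most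
one unmarked edge (flag `false`) between an agent and an item. -/
abbrev Edge (N M : Type*) := N × M × Bool

/-- `j` is a large item for agent `i`. -/
def IsLargeItem {N M : Type*} (y : N → Finset M → ℝ) (κ : N → Finset M → M)
    (i : N) (j : M) : Prop :=
  ∃ S, 0 < y i S ∧ κ i S = j

/-- `j` is a small item for agent `i`. -/
def IsSmallItem {N M : Type*} [DecidableEq M] (y : N → Finset M → ℝ) (κ : N → Finset M → M)
    (i : N) (j : M) : Prop :=
  ∃ S, 0 < y i S ∧ j ∈ S.erase (κ i S)

/-- The edges of the multigraph: marked edges to large items, unmarked edges to small items. -/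
def IsEdge {N M : Type*} [DecidableEq M] (y : N → Finset M → ℝ) (κ : N → Finset M → M)
    (e : Edge N M) : Prop :=
  if e.2.2 then IsLargeItem y κ e.1 e.2.1 else IsSmallItem y κ e.1 e.2.1

/-- The fractional vector `x*`. It is given on all possible edges; by `xStar_pos_iff` it vanishes
exactly off the edge set, so it carries the same information as its restriction to the edges. -/
def xStar {N M : Type*} [Fintype M] [DecidableEq M] (y : N → Finset M → ℝ)
    (κ : N → Finset M → M) (e : Edge N M) : ℝ :=
  if e.2.2 then ∑ S : Finset M with κ e.1 S = e.2.1, y e.1 S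
  else ∑ S : Finset M with e.2.1 ∈ S.erase (κ e.1 S), y e.1 S

theorem xStar_pos_iff {N M : Type*} [Fintype M] [DecidableEq M] {y : N → Finset M → ℝ}
    (hy : ∀ i S, 0 ≤ y i S) (κ : N → Finset M → M) (e : Edge N M) :
    0 < xStar y κ e ↔ IsEdge y κ e := by
  obtain ⟨i, j, b⟩ := e
  cases b
  · simp only [xStar, IsEdge, IsSmallItem, Bool.false_eq_true, if_false]
    rw [Finset.sum_pos_iff_of_nonneg (fun S _ => hy i S)]
    simp only [Finset.mem_filter, Finset.mem_univ, true_and]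
    exact exists_congr fun S => and_comm
  · simp only [xStar, IsEdge, IsLargeItem, if_true]
    rw [Finset.sum_pos_iff_of_nonneg (fun S _ => hy i S)]
    simp only [Finset.mem_filter, Finset.mem_univ, true_and]
    exact exists_congr fun S => and_comm

/-- An alternating sequence `(i₀, j₀, i₁, j₁, …, i_{k-1}, j_{k-1}, i_k)` of agents and items,
either a candidate marked cycle or a candidate pseudo-marked path. Only the agents with index
`≤ k` and the items with index `< k` matter. -/
structure AltSeq (N M : Type*) where
  len : ℕ
  agent : ℕ → N
  item : ℕ → M
  isCycle : Bool

namespace AltSeq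

variable {N M : Type*}

/-- The edge `i_a j_a`: marked, except for the first edge of a pseudo-marked path. -/
def fwd (w : AltSeq N M) (a : ℕ) : Edge N M :=
  (w.agent a, w.item a, w.isCycle || decide (a ≠ 0))

/-- The edge `j_a i_{a+1}`: marked, except for the last edge of a pseudo-marked path. -/
def bwd (w : AltSeq N M) (a : ℕ) : Edge N M :=
  (w.agent (a + 1), w.item a, w.isCycle || decide (a + 1 ≠ w.len))

/-- All edges of the sequence have `x`-value strictly between `0` and `1`. -/
def InFracSupp (w : AltSeq N M) (x : Edge N M → ℝ) : Prop :=
  ∀ a < w.len, x (w.fwd a) ∈ Set.Ioo (0 : ℝ) 1 ∧ x (w.bwd a) ∈ Set.Ioo (0 : ℝ) 1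

/-- A simple cycle all of whose edges are marked. As there are no parallel marked edges, it has at
least two items. -/
def IsMarkedCycle (w : AltSeq N M) : Prop :=
  w.isCycle = true ∧ 2 ≤ w.len ∧ w.agent w.len = w.agent 0 ∧
    Set.InjOn w.agent (Set.Iio w.len) ∧ Set.InjOn w.item (Set.Iio w.len)

/-- A pseudo-marked path: `(j₀, i₁, …, i_{k-1}, j_{k-1})` is a simple path of marked edges, and
`i₀ j₀`, `j_{k-1} i_k` are distinct unmarked edges. -/
def IsPseudoMarkedPath (w : AltSeq N M) : Prop :=
  w.isCycle = false ∧ 1 ≤ w.len ∧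
    Set.InjOn w.agent (Set.Ioo 0 w.len) ∧ Set.InjOn w.item (Set.Iio w.len) ∧
    w.fwd 0 ≠ w.bwd (w.len - 1)

/-- The step size `δ₁`. -/
def delta₁ (w : AltSeq N M) (x : Edge N M → ℝ) : ℝ :=
  ⨅ a : Fin w.len, min (x (w.fwd a)) (1 - x (w.bwd a))

/-- The step size `δ₂`. -/
def delta₂ (w : AltSeq N M) (x : Edge N M → ℝ) : ℝ :=
  ⨅ a : Fin w.len, min (1 - x (w.fwd a)) (x (w.bwd a))

/-- Decrease `x` by `d` on the edges `i_a j_a` and increase it by `d` on the edges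
`j_a i_{a+1}`. -/
def shift [DecidableEq N] [DecidableEq M] (w : AltSeq N M) (x : Edge N M → ℝ) (d : ℝ) :
    Edge N M → ℝ := fun e =>
  x e - (∑ a ∈ Finset.range w.len, if w.fwd a = e then d else 0)
    + ∑ a ∈ Finset.range w.len, if w.bwd a = e then d else 0

end AltSeq

/-- `IsRoundingLaw x μ`: `μ` is the law of the vector returned by some execution strategy of the
iterative rounding procedure started at `x`. The cycle or path used in an iteration may be chosen
arbitrarily, depending on the whole history and on additional randomness (`randomize`). -/
inductive IsRoundingLaw {N M : Type*} [DecidableEq N] [DecidableEq M] :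
    (Edge N M → ℝ) → Measure (Edge N M → ℝ) → Prop
  | done (x : Edge N M → ℝ) (hx : ∀ e, x e = 0 ∨ x e = 1) :
      IsRoundingLaw x (Measure.dirac x)
  | step (x : Edge N M → ℝ) (w : AltSeq N M) (hw : w.IsMarkedCycle ∨ w.IsPseudoMarkedPath)
      (hx : w.InFracSupp x) (μ₁ μ₂ : Measure (Edge N M → ℝ))
      (h₁ : IsRoundingLaw (w.shift x (w.delta₁ x)) μ₁)
      (h₂ : IsRoundingLaw (w.shift x (-w.delta₂ x)) μ₂) :
      IsRoundingLaw x
        (ENNReal.ofReal (w.delta₂ x / (w.delta₁ x + w.delta₂ x)) • μ₁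
          + ENNReal.ofReal (w.delta₁ x / (w.delta₁ x + w.delta₂ x)) • μ₂)
  | randomize (x : Edge N M → ℝ) (ι : Type) (q : PMF ι) (μ : ι → Measure (Edge N M → ℝ))
      (h : ∀ a, IsRoundingLaw x (μ a)) :
      IsRoundingLaw x (Measure.sum fun a => q a • μ a)

open Classical in
/-- The set of small items assigned to agent `i` by the output vector `X`: the items whose
unmarked edge to `i` is chosen. -/
def smallAssigned {N M : Type*} [Fintype M] (i : N) (X : Edge N M → ℝ) : Finset M :=
  {j : M | X (i, j, false) = 1}

/-- `L` lists all configurations of an agent with valuation `v`, LP values `y` and largest items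
`κ`, in descending order of the value of the largest item (ties in any order). -/
structure IsSortedConfigs {M : Type*} (v y : Finset M → ℝ) (κ : Finset M → M)
    (L : List (Finset M)) : Prop where
  nodup : L.Nodup
  mem_iff : ∀ S, S ∈ L ↔ 0 < y S
  sorted : L.Pairwise fun S S' => v {κ S'} ≤ v {κ S}

open Classical in
/-- `configAt y L t` is the first set `S` in the list `L` such that the sum of `y S'` over all `S'`
up to and including `S` is at least `t`. -/
def configAt {M : Type*} (y : Finset M → ℝ) : List (Finset M) → ℝ → Finset M
  | [], _ => ∅
  | S :: L, t => if t ≤ y S then S else configAt y L (t - y S)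

/-- `u_t`: the value of the largest item of the configuration at position `t`. -/
def largeValue {M : Type*} (v y : Finset M → ℝ) (κ : Finset M → M) (L : List (Finset M))
    (t : ℝ) : ℝ :=
  v {κ (configAt y L t)}

/-- `B_t`: the value of the configuration at position `t` without its largest item. -/
def smallValue {M : Type*} [DecidableEq M] (v y : Finset M → ℝ) (κ : Finset M → M)
    (L : List (Finset M)) (t : ℝ) : ℝ :=
  v ((configAt y L t).erase (κ (configAt y L t)))

/-- For `0 < t ≤ 1`: the largest `A` such that the small items assigned to `i` are worth at least
`A` with probability at least `t`. -/
def outputQuantilePos {N M : Type*} [Fintype M] (v : Finset M → ℝ)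
    (μ : Measure (Edge N M → ℝ)) (i : N) (t : ℝ) : ℝ :=
  sSup {A : ℝ | ENNReal.ofReal t ≤ μ {X | A ≤ v (smallAssigned i X)}}

/-- `C_t` for `0 ≤ t ≤ 1`, with `C_0` the limit of `C_t` for `t → 0+`. -/
def outputQuantile {N M : Type*} [Fintype M] (v : Finset M → ℝ)
    (μ : Measure (Edge N M → ℝ)) (i : N) (t : ℝ) : ℝ :=
  if t = 0 then limUnder (𝓝[>] (0 : ℝ)) (outputQuantilePos v μ i)
  else outputQuantilePos v μ i t

/-- The logarithm of a non-negative real number, with `ln 0 = -∞`. -/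
def ln (a : ℝ) : EReal := ENNReal.log (ENNReal.ofReal a)

/-- The set of `t ∈ [0, 1]` with `ln B_t > ln (u_t + C_t) + lam`. -/
def badSet {N M : Type*} [Fintype M] [DecidableEq M] (v y : Finset M → ℝ) (κ : Finset M → M)
    (L : List (Finset M)) (μ : Measure (Edge N M → ℝ)) (i : N) (lam : ℝ) : Set ℝ :=
  {t ∈ Set.Icc (0 : ℝ) 1 |
    ln (smallValue v y κ L t) > ln (largeValue v y κ L t + outputQuantile v μ i t) + (lam : EReal)}

end NashWelfare

end

/-! For `lam ≤ 5/2` the bound is at least 1 and nothing is to prove. Otherwise put `K = e^lam` and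
`s = 1 - 1/K`. The positions `t > s` have measure `1/K`. For `0 < t ≤ s` the quantile `C_t` is at
least `c = C_s`, so a bad `t` lies on a configuration `S` whose small part `Q S` is worth more than
`K (u_S + c)`. It remains to bound the total weight `Y` of such bad configurations by `6 lam / K`
(`sum_badConfigs_le`).

Raise `c` to some `C > c` for which all bad configurations still satisfy `K (u_S + C) ≤ v (Q S)`. By
definition of the quantile, the small items received are worth less than `C` with probability at
least `1/K`, so `exp (-v/C)` has expectation at least `e^(-1) / K`. Two estimates bound this
expectation from above.

Rounding is no worse than independent sampling (`IsRoundingLaw.lintegral_le`). The function `exp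
(-v/C)` is supermodular, so its multilinear extension is concave in every direction `e_b - e_a`. A
rounding step moves at most two unmarked edges of the agent, in opposite directions and with mean
zero. Hence the extension does not increase in expectation, and at the integral end it is the
function itself.

Independent sampling has a small lower tail (`multilinearExt_exp_neg_le`). For a decreasing
function, sampling with marginals `∑ y S` is no worse than joining separate samples of the sets `Q
S`, each item taken with probability `y S`. As long as the value is below `K C / 2`, a bad `Q S`
still has marginal value at least `K (u_S + C) / 2`, in pieces of size at most `u_S`, and its sample
shrinks the expectation by `exp (-K y_S / 2)`. Cutting off the values above `K C / 2` costs `exp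
(-K/2)`.

Together `e^(-1-lam) ≤ e^(-K Y/2) + e^(-K/2)`. The last term is negligible for `lam ≥ 5/2`, which
leaves `K Y ≤ 2 lam + 4 ≤ 6 lam`. -/

noncomputable section

namespace NashWelfare

/-! ### The multilinear extension of a set function -/

/-- The multilinear extension of `g`: the expectation of `g` on a random set that contains each
`j` independently with probability `x j`. -/
def multilinearExt {M : Type*} [Fintype M] [DecidableEq M] (g : Finset M → ℝ) (x : M → ℝ) : ℝ :=
  ∑ A : Finset M, g A * ∏ j, if j ∈ A then x j else 1 - x j

section Multilinear

variable {M : Type*} [Fintype M] [DecidableEq M]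

theorem sum_finset_eq_sum_powerset_erase (a : M) (f : Finset M → ℝ) :
    ∑ A : Finset M, f A
      = ∑ A ∈ (Finset.univ.erase a).powerset, (f A + f (insert a A)) := by
  rw [Finset.sum_add_distrib, ← Finset.sum_powerset_insert (Finset.notMem_erase a _),
    Finset.insert_erase (Finset.mem_univ a), Finset.powerset_univ]

theorem prod_weight_eq (a : M) (x : M → ℝ) (A : Finset M) :
    (∏ j, if j ∈ A then x j else 1 - x j)
      = (if a ∈ A then x a else 1 - x a)
        * ∏ j ∈ Finset.univ.erase a, if j ∈ A then x j else 1 - x j :=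
  (Finset.mul_prod_erase _ _ (Finset.mem_univ a)).symm

theorem multilinearExt_update (g : Finset M → ℝ) (x : M → ℝ) (a : M) (α : ℝ) :
    multilinearExt g (Function.update x a α)
      = α * multilinearExt (fun A => g (insert a A)) x
        + (1 - α) * multilinearExt (fun A => g (A.erase a)) x := by
  unfold multilinearExt
  rw [sum_finset_eq_sum_powerset_erase a, sum_finset_eq_sum_powerset_erase a,
    sum_finset_eq_sum_powerset_erase a, Finset.mul_sum, Finset.mul_sum,
    ← Finset.sum_add_distrib]
  refine Finset.sum_congr rfl fun A hA => ?_
  have ha : a ∉ A := fun h => by simpa using Finset.mem_powerset.1 hA h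
  have e1 : (∏ j ∈ Finset.univ.erase a,
        if j ∈ A then Function.update x a α j else 1 - Function.update x a α j)
      = ∏ j ∈ Finset.univ.erase a, if j ∈ A then x j else 1 - x j :=
    Finset.prod_congr rfl fun j hj => by
      rw [Function.update_of_ne (Finset.ne_of_mem_erase hj)]
  have e2 : ∀ z : M → ℝ, (∏ j ∈ Finset.univ.erase a, if j ∈ insert a A then z j else 1 - z j)
      = ∏ j ∈ Finset.univ.erase a, if j ∈ A then z j else 1 - z j := fun z =>
    Finset.prod_congr rfl fun j hj => by
      simp [Finset.mem_insert, Finset.ne_of_mem_erase hj]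
  simp only [prod_weight_eq a, e2, e1, ha, Finset.mem_insert_self, if_true, if_false,
    Function.update_self, Finset.insert_idem, Finset.erase_eq_of_notMem ha,
    Finset.erase_insert ha]
  ring

theorem multilinearExt_eq_insert_erase (g : Finset M → ℝ) (x : M → ℝ) (a : M) :
    multilinearExt g x = x a * multilinearExt (fun A => g (insert a A)) x
        + (1 - x a) * multilinearExt (fun A => g (A.erase a)) x := by
  conv_lhs => rw [← Function.update_eq_self a x]
  exact multilinearExt_update g x a (x a)

theorem multilinearExt_mono {g h : Finset M → ℝ} (hgh : ∀ A, g A ≤ h A) {x : M → ℝ}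
    (hx : ∀ j, x j ∈ Set.Icc (0 : ℝ) 1) : multilinearExt g x ≤ multilinearExt h x := by
  refine Finset.sum_le_sum fun A _ => mul_le_mul_of_nonneg_right (hgh A) ?_
  refine Finset.prod_nonneg fun j _ => ?_
  split_ifs
  · exact (hx j).1
  · exact sub_nonneg.2 (hx j).2

theorem multilinearExt_add (g h : Finset M → ℝ) (x : M → ℝ) :
    multilinearExt (fun A => g A + h A) x = multilinearExt g x + multilinearExt h x := by
  simp only [multilinearExt, add_mul, Finset.sum_add_distrib]

theorem multilinearExt_const_mul (c : ℝ) (g : Finset M → ℝ) (x : M → ℝ) :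
    multilinearExt (fun A => c * g A) x = c * multilinearExt g x := by
  simp only [multilinearExt, mul_assoc, Finset.mul_sum]

theorem multilinearExt_indicator (g : Finset M → ℝ) (B : Finset M) {x : M → ℝ}
    (h1 : ∀ j ∈ B, x j = 1) (h0 : ∀ j ∉ B, x j = 0) : multilinearExt g x = g B := by
  unfold multilinearExt
  rw [Finset.sum_eq_single B]
  · rw [Finset.prod_eq_one, mul_one]
    intro j _
    split_ifs with h
    · exact h1 j h
    · rw [h0 j h, sub_zero]
  · intro A _ hA
    obtain ⟨j, hj⟩ : ∃ j, ¬ (j ∈ A ↔ j ∈ B) := by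
      by_contra! h
      exact hA (Finset.ext h)
    rw [Finset.prod_eq_zero (Finset.mem_univ j), mul_zero]
    by_cases hjA : j ∈ A
    · rw [if_pos hjA, h0 j (by tauto)]
    · rw [if_neg hjA, h1 j (by tauto), sub_self]
  · simp

/-- Changing one coordinate does not alter the value, so the coordinates can be set to zero one at a
time. No bounds on `x` are needed. -/
theorem multilinearExt_const (c : ℝ) (x : M → ℝ) : multilinearExt (fun _ => c) x = c := by
  suffices h : ∀ s : Finset M, (∀ j ∉ s, x j = 0) → multilinearExt (fun _ => c) x = c from
    h Finset.univ (by simp)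
  intro s
  induction s using Finset.induction_on generalizing x with
  | empty =>
    intro h
    exact multilinearExt_indicator _ ∅ (by simp) h
  | insert a s ha ih =>
    intro h
    have h0 := ih (Function.update x a 0) fun j hj => by
      by_cases hja : j = a
      · simp [hja]
      · rw [Function.update_of_ne hja]
        exact h j (by simp [hja, hj])
    rw [multilinearExt_update] at h0
    rw [multilinearExt_eq_insert_erase _ x a]
    linarith

/-- Along a direction `e_b - e_a` the multilinear extension of a supermodular function is
concave. -/
theorem multilinearExt_exchange_le {g : Finset M → ℝ}
    (hg : ∀ S T, g S + g T ≤ g (S ∪ T) + g (S ∩ T)) {x : M → ℝ}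
    (hx : ∀ j, x j ∈ Set.Icc (0 : ℝ) 1) {a b : M} (hab : a ≠ b) {p q d d' : ℝ}
    (hp : 0 ≤ p) (hq : 0 ≤ q) (hpq : p + q = 1) (hd : p * d = q * d') :
    p * multilinearExt g (Function.update (Function.update x a (x a - d)) b (x b + d))
      + q * multilinearExt g (Function.update (Function.update x a (x a + d')) b (x b - d'))
      ≤ multilinearExt g x := by
  -- Supermodularity is applied to two sets that agree off `{a, b}`, one containing only `b` and the
  -- other only `a`. This makes the mixed second difference of the extension in `a` and `b`
  -- non-negative.
  have key := multilinearExt_mono (x := x)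
    (g := fun A => g (insert b (A.erase a)) + g ((insert a A).erase b))
    (h := fun A => g (insert b (insert a A)) + g ((A.erase a).erase b)) (fun A => by
      have e := hg (insert b (A.erase a)) ((insert a A).erase b)
      have e1 : insert b (A.erase a) ∪ (insert a A).erase b = insert b (insert a A) := by
        ext j; grind
      have e2 : insert b (A.erase a) ∩ (insert a A).erase b = (A.erase a).erase b := by
        ext j; grind
      rwa [e1, e2] at e) hx
  rw [multilinearExt_add, multilinearExt_add] at key
  have h0 : multilinearExt g x
      = multilinearExt g (Function.update (Function.update x a (x a)) b (x b)) := by simp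
  rw [h0]
  simp only [multilinearExt_update]
  set G11 := multilinearExt (fun A => g (insert b (insert a A))) x
  set G01 := multilinearExt (fun A => g (insert b (A.erase a))) x
  set G10 := multilinearExt (fun A => g ((insert a A).erase b)) x
  set G00 := multilinearExt (fun A => g ((A.erase a).erase b)) x
  have hk : 0 ≤ (p * d ^ 2 + q * d' ^ 2) * (G11 + G00 - (G01 + G10)) :=
    mul_nonneg (by positivity) (by linarith)
  obtain rfl : q = 1 - p := by linarith
  have hd2 : p * d - (1 - p) * d' = 0 := by linarith
  -- In the coordinates `a`, `b` the extension is bilinear. The first-order terms cancel by `p * d =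
  -- q * d'`, and only the mixed difference times the variance remains.
  have : (x b * (x a * G11 + (1 - x a) * G01) + (1 - x b) * (x a * G10 + (1 - x a) * G00))
      - (p * ((x b + d) * ((x a - d) * G11 + (1 - (x a - d)) * G01)
          + (1 - (x b + d)) * ((x a - d) * G10 + (1 - (x a - d)) * G00))
        + (1 - p) * ((x b - d') * ((x a + d') * G11 + (1 - (x a + d')) * G01)
          + (1 - (x b - d')) * ((x a + d') * G10 + (1 - (x a + d')) * G00)))
      = (p * d ^ 2 + (1 - p) * d' ^ 2) * (G11 + G00 - (G01 + G10))
        + (p * d - (1 - p) * d') * ((x b - x a) * (G11 + G00 - (G01 + G10)) + G10 - G01) := by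
    ring
  rw [hd2] at this
  linarith

theorem multilinearExt_single_eq (g : Finset M → ℝ) (x : M → ℝ) (a : M) {p q d d' : ℝ}
    (hpq : p + q = 1) (hd : p * d = q * d') :
    p * multilinearExt g (Function.update x a (x a - d))
      + q * multilinearExt g (Function.update x a (x a + d')) = multilinearExt g x := by
  rw [multilinearExt_eq_insert_erase g x a, multilinearExt_update, multilinearExt_update]
  linear_combination (multilinearExt (fun A => g (A.erase a)) x
    - multilinearExt (fun A => g (insert a A)) x) * hd
    + (x a * multilinearExt (fun A => g (insert a A)) x
        + (1 - x a) * multilinearExt (fun A => g (A.erase a)) x) * hpq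

end Multilinear

/-! ### Adding a sampled set -/

section SampleUnion

variable {M : Type*} [DecidableEq M]

/-- `sampleUnion p l g A` is the expectation of `g` on `A` joined with a random subset of the list
`l` that contains each member independently with probability `p`. -/
def sampleUnion (p : ℝ) : List M → (Finset M → ℝ) → Finset M → ℝ
  | [], g, A => g A
  | j :: l, g, A => p * sampleUnion p l g (insert j A) + (1 - p) * sampleUnion p l g A

theorem sampleUnion_mono {p : ℝ} (hp : p ∈ Set.Icc (0 : ℝ) 1) {g h : Finset M → ℝ}
    (hgh : ∀ A, g A ≤ h A) (l : List M) (A : Finset M) :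
    sampleUnion p l g A ≤ sampleUnion p l h A := by
  induction l generalizing A with
  | nil => exact hgh A
  | cons j l ih =>
    exact add_le_add (mul_le_mul_of_nonneg_left (ih _) hp.1)
      (mul_le_mul_of_nonneg_left (ih _) (sub_nonneg.2 hp.2))

theorem sampleUnion_antitone {p : ℝ} (hp : p ∈ Set.Icc (0 : ℝ) 1) {g : Finset M → ℝ}
    (hg : Antitone g) (l : List M) : Antitone (sampleUnion p l g) := by
  induction l with
  | nil => exact hg
  | cons j l ih =>
    intro A B hAB
    exact add_le_add (mul_le_mul_of_nonneg_left (ih (Finset.insert_subset_insert j hAB)) hp.1)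
      (mul_le_mul_of_nonneg_left (ih hAB) (sub_nonneg.2 hp.2))

theorem sampleUnion_le_self {p : ℝ} (hp : p ∈ Set.Icc (0 : ℝ) 1) {g : Finset M → ℝ}
    (hg : Antitone g) (l : List M) (A : Finset M) : sampleUnion p l g A ≤ g A := by
  induction l generalizing A with
  | nil => exact le_rfl
  | cons j l ih =>
    have h1 := mul_le_mul_of_nonneg_left ((ih (insert j A)).trans (hg (Finset.subset_insert j A)))
      hp.1
    have h2 := mul_le_mul_of_nonneg_left (ih A) (sub_nonneg.2 hp.2)
    simp only [sampleUnion]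
    linarith

/-- Inserting `a` by an independent coin raises its marginal only to `x a + p - p * x a`, because
both sources may pick it. A decreasing function is then at least as large. -/
theorem multilinearExt_update_add_le [Fintype M] {h : Finset M → ℝ} (hh : Antitone h) {x : M → ℝ}
    (hx : ∀ j, x j ∈ Set.Icc (0 : ℝ) 1) (a : M) {p : ℝ} (hp : 0 ≤ p) :
    multilinearExt h (Function.update x a (x a + p))
      ≤ multilinearExt (fun A => p * h (insert a A) + (1 - p) * h A) x := by
  rw [multilinearExt_add, multilinearExt_const_mul, multilinearExt_const_mul,
    multilinearExt_update, multilinearExt_eq_insert_erase h x a]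
  have h1 : multilinearExt (fun A => h (insert a A)) x
      ≤ multilinearExt (fun A => h (A.erase a)) x :=
    multilinearExt_mono
      (fun A => hh ((Finset.erase_subset a A).trans (Finset.subset_insert a A))) hx
  nlinarith [mul_nonneg (mul_nonneg hp (hx a).1) (sub_nonneg.2 h1)]

/-- Raising the marginals of the members of `l` by `p` costs at most as much as joining an
independent sample of `l`. -/
theorem multilinearExt_add_le_sampleUnion [Fintype M] {h : Finset M → ℝ} (hh : Antitone h) {p : ℝ}
    (hp : p ∈ Set.Icc (0 : ℝ) 1) {l : List M} (hl : l.Nodup) {x : M → ℝ}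
    (hx : ∀ j, 0 ≤ x j) (hx' : ∀ j, (x j + if j ∈ l then p else 0) ≤ 1) :
    multilinearExt h (fun j => x j + if j ∈ l then p else 0)
      ≤ multilinearExt (sampleUnion p l h) x := by
  induction l generalizing x with
  | nil => simp [sampleUnion]
  | cons a l ih =>
    obtain ⟨hal, hl⟩ := List.nodup_cons.1 hl
    have hxI : ∀ j, x j ∈ Set.Icc (0 : ℝ) 1 := fun j => ⟨hx j, by
      have := hx' j
      split_ifs at this
      · linarith [hp.1]
      · linarith⟩
    have e : (fun j => x j + if j ∈ a :: l then p else 0)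
        = fun j => Function.update x a (x a + p) j + if j ∈ l then p else 0 := by
      funext j
      by_cases hj : j = a
      · subst hj
        simp [hal]
      · simp [hj]
    rw [e]
    refine (ih hl ?_ ?_).trans
      (multilinearExt_update_add_le (sampleUnion_antitone hp hh l) hxI a hp.1)
    · intro j
      by_cases hj : j = a
      · subst hj
        simpa using add_nonneg (hx j) hp.1
      · simpa [hj] using hx j
    · intro j
      exact (congrFun e j).symm.le.trans (hx' j)

end SampleUnion

/-! ### Valuations and their exponentials -/

namespace IsValuation

variable {M : Type*} [DecidableEq M] {v : Finset M → ℝ}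

theorem marginal_le (hv : IsValuation v) {A P : Finset M} (hAP : A ⊆ P) (j : M) :
    v (insert j P) - v P ≤ v (insert j A) - v A := by
  have h := hv.submodular (insert j A) P
  rw [Finset.insert_union, Finset.union_eq_right.2 hAP] at h
  have := hv.mono A (insert j A ∩ P) (Finset.subset_inter (Finset.subset_insert j A) hAP)
  linarith

theorem marginal_le_singleton (hv : IsValuation v) (P : Finset M) (j : M) :
    v (insert j P) - v P ≤ v {j} := by
  have := hv.marginal_le (Finset.empty_subset P) j
  rwa [hv.empty, sub_zero, insert_empty_eq] at this

theorem eq_zero_of_singletons (hv : IsValuation v) {Q : Finset M} (hQ : ∀ j ∈ Q, v {j} ≤ 0) :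
    v Q = 0 := by
  induction Q using Finset.induction_on with
  | empty => exact hv.empty
  | insert a Q ha ih =>
    have h1 := ih fun j hj => hQ j (Finset.mem_insert_of_mem hj)
    have h2 := hv.marginal_le_singleton Q a
    have h3 := hQ a (Finset.mem_insert_self a Q)
    exact le_antisymm (by linarith) (hv.nonneg _)

theorem exp_neg_antitone (hv : IsValuation v) {θ : ℝ} (hθ : 0 ≤ θ) :
    Antitone fun A => Real.exp (-(θ * v A)) := fun A B hAB =>
  Real.exp_le_exp.2 (neg_le_neg (mul_le_mul_of_nonneg_left (hv.mono A B hAB) hθ))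

/-- With `m = v (S ∩ T)` factored out, this is `(1 - e^(-a)) * (1 - e^(-b)) ≥ 0` for the scaled
gains `a`, `b` of `S` and `T` over `S ∩ T`. Submodularity bounds the gain of `S ∪ T` by `a + b`. -/
theorem exp_neg_supermodular (hv : IsValuation v) {θ : ℝ} (hθ : 0 ≤ θ) (S T : Finset M) :
    Real.exp (-(θ * v S)) + Real.exp (-(θ * v T))
      ≤ Real.exp (-(θ * v (S ∪ T))) + Real.exp (-(θ * v (S ∩ T))) := by
  have hS := mul_le_mul_of_nonneg_left (hv.mono (S ∩ T) S Finset.inter_subset_left) hθ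
  have hT := mul_le_mul_of_nonneg_left (hv.mono (S ∩ T) T Finset.inter_subset_right) hθ
  have hU := mul_le_mul_of_nonneg_left (hv.submodular S T) hθ
  have e1 : Real.exp (-(θ * v S)) = Real.exp (-(θ * v (S ∩ T)))
      * Real.exp (-(θ * v S - θ * v (S ∩ T))) := by rw [← Real.exp_add]; ring_nf
  have e2 : Real.exp (-(θ * v T)) = Real.exp (-(θ * v (S ∩ T)))
      * Real.exp (-(θ * v T - θ * v (S ∩ T))) := by rw [← Real.exp_add]; ring_nf
  have e3 : Real.exp (-(θ * v (S ∩ T))) * (Real.exp (-(θ * v S - θ * v (S ∩ T)))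
      * Real.exp (-(θ * v T - θ * v (S ∩ T)))) ≤ Real.exp (-(θ * v (S ∪ T))) := by
    rw [← Real.exp_add, ← Real.exp_add]
    exact Real.exp_le_exp.2 (by linarith)
  have l1 : Real.exp (-(θ * v S - θ * v (S ∩ T))) ≤ 1 := Real.exp_le_one_iff.2 (by linarith)
  have l2 : Real.exp (-(θ * v T - θ * v (S ∩ T))) ≤ 1 := Real.exp_le_one_iff.2 (by linarith)
  have l3 := mul_nonneg (Real.exp_pos (-(θ * v (S ∩ T)))).le
    (mul_nonneg (sub_nonneg.2 l1) (sub_nonneg.2 l2))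
  rw [e1, e2]
  linarith

end IsValuation

/-- Convexity: the graph lies below its chord over `[0, u]`. -/
theorem exp_neg_mul_le_one_sub {θ u w : ℝ} (hu : 0 < u) (hw : w ∈ Set.Icc 0 u) :
    Real.exp (-(θ * w)) ≤ 1 - (1 - Real.exp (-(θ * u))) / u * w := by
  have h := convexOn_exp.2 (Set.mem_univ (-(θ * u))) (Set.mem_univ 0) (div_nonneg hw.1 hu.le)
    (sub_nonneg.2 ((div_le_one hu).2 hw.2)) (add_sub_cancel (w / u) 1)
  simp only [smul_eq_mul, mul_zero, add_zero, Real.exp_zero, mul_one] at h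
  have e : w / u * -(θ * u) = -(θ * w) := by field_simp
  rw [e] at h
  refine h.trans (le_of_eq ?_)
  field_simp
  ring

/-! ### Lower tail of independent sampling -/

section Tail

variable {M : Type*}

open Classical in
/-- The function `exp (-θ v)`, cut off to zero where `v` reaches the level `D`. -/
def cutExp (v : Finset M → ℝ) (θ D : ℝ) (A : Finset M) : ℝ :=
  if v A < D then Real.exp (-(θ * v A)) else 0

theorem cutExp_nonneg (v : Finset M → ℝ) (θ D : ℝ) (A : Finset M) : 0 ≤ cutExp v θ D A := by
  unfold cutExp
  split_ifs
  · exact (Real.exp_pos _).le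
  · exact le_rfl

theorem cutExp_le (v : Finset M → ℝ) (θ D : ℝ) (A : Finset M) :
    cutExp v θ D A ≤ Real.exp (-(θ * v A)) := by
  unfold cutExp
  split_ifs
  · exact le_rfl
  · exact (Real.exp_pos _).le

variable [DecidableEq M] {v : Finset M → ℝ}

/-- Marginals are measured over `P`, which absorbs every item processed, sampled or not. They
telescope to `v (P ∪ l.toFinset) - v P` whatever the coins show, and by submodularity they bound
from below the gains over the smaller set `A` actually sampled. -/
theorem sampleUnion_exp_neg_le (hv : IsValuation v) {θ u p : ℝ} (hθ : 0 ≤ θ) (hu : 0 < u)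
    (hp : p ∈ Set.Icc (0 : ℝ) 1) {l : List M} (hl : ∀ j ∈ l, v {j} ≤ u) {A P : Finset M}
    (hAP : A ⊆ P) :
    sampleUnion p l (fun A => Real.exp (-(θ * v A))) A
      ≤ Real.exp (-(θ * v A))
        * Real.exp (-(p * ((1 - Real.exp (-(θ * u))) / u) * (v (P ∪ l.toFinset) - v P))) := by
  set c := (1 - Real.exp (-(θ * u))) / u with hc
  induction l generalizing A P with
  | nil => simp [sampleUnion]
  | cons j l ih =>
    have ih' : ∀ {A P : Finset M}, A ⊆ P → _ := fun {A P} h =>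
      ih (fun k hk => hl k (List.mem_cons_of_mem j hk)) (A := A) (P := P) h
    have h1 := ih' (Finset.insert_subset_insert j hAP)
    have h2 := ih' (hAP.trans (Finset.subset_insert j P))
    have hun : P ∪ (j :: l).toFinset = insert j P ∪ l.toFinset := by
      ext k; simp
    rw [hun]
    set V := v (insert j P ∪ l.toFinset)
    set w := v (insert j P) - v P with hw
    have hw0 : 0 ≤ w := sub_nonneg.2 (hv.mono _ _ (Finset.subset_insert j P))
    have hwu : w ≤ u := (hv.marginal_le_singleton P j).trans (hl j List.mem_cons_self)
    have hwA : w ≤ v (insert j A) - v A := hv.marginal_le hAP j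
    have e1 : Real.exp (-(θ * v (insert j A))) ≤ Real.exp (-(θ * v A)) * (1 - c * w) := by
      refine le_trans ?_ (mul_le_mul_of_nonneg_left
        (exp_neg_mul_le_one_sub (θ := θ) hu ⟨hw0, hwu⟩) (Real.exp_pos _).le)
      rw [← Real.exp_add]
      refine Real.exp_le_exp.2 ?_
      have := mul_le_mul_of_nonneg_left hwA hθ
      linarith
    have e2 : 1 - p * c * w ≤ Real.exp (-(p * c * w)) := by
      have := Real.add_one_le_exp (-(p * c * w))
      linarith
    have e3 : Real.exp (-(p * c * (V - v P)))
        = Real.exp (-(p * c * w)) * Real.exp (-(p * c * (V - v (insert j P)))) := by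
      rw [← Real.exp_add, hw]
      ring_nf
    set q := Real.exp (-(p * c * (V - v (insert j P))))
    have hq : 0 < q := Real.exp_pos _
    have hp' := sub_nonneg.2 hp.2
    calc sampleUnion p (j :: l) (fun A => Real.exp (-(θ * v A))) A
        ≤ p * (Real.exp (-(θ * v (insert j A))) * q) + (1 - p) * (Real.exp (-(θ * v A)) * q) :=
          add_le_add (mul_le_mul_of_nonneg_left h1 hp.1) (mul_le_mul_of_nonneg_left h2 hp')
      _ ≤ p * (Real.exp (-(θ * v A)) * (1 - c * w) * q)
            + (1 - p) * (Real.exp (-(θ * v A)) * q) := by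
          gcongr
          exact hp.1
      _ = Real.exp (-(θ * v A)) * ((1 - p * c * w) * q) := by ring
      _ ≤ Real.exp (-(θ * v A)) * (Real.exp (-(p * c * w)) * q) := by gcongr
      _ = _ := by rw [e3]

theorem cutExp_antitone (hv : IsValuation v) {θ : ℝ} (hθ : 0 ≤ θ) (D : ℝ) :
    Antitone (cutExp v θ D) := by
  intro A B hAB
  by_cases hB : v B < D
  · have hA : v A < D := (hv.mono A B hAB).trans_lt hB
    simp only [cutExp, if_pos hA, if_pos hB]
    exact hv.exp_neg_antitone hθ hAB
  · simp only [cutExp, if_neg hB]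
    exact cutExp_nonneg v θ D A

theorem sampleUnion_cutExp_le (hv : IsValuation v) {C K u p : ℝ} (hC : 0 < C) (hK : 0 ≤ K)
    (hp : p ∈ Set.Icc (0 : ℝ) 1) {Q : Finset M} (hu : 0 < u) (hQ : ∀ j ∈ Q, v {j} ≤ u)
    (hval : K * (u + C) ≤ v Q) (A : Finset M) :
    sampleUnion p Q.toList (cutExp v C⁻¹ (K * C / 2)) A
      ≤ Real.exp (-(K / 2 * p)) * cutExp v C⁻¹ (K * C / 2) A := by
  have hθ : 0 ≤ C⁻¹ := (inv_pos.2 hC).le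
  by_cases hA : v A < K * C / 2
  · have h1 := sampleUnion_mono hp (cutExp_le v C⁻¹ (K * C / 2)) Q.toList A
    have h2 := sampleUnion_exp_neg_le hv hθ hu hp (l := Q.toList) (by simpa using hQ)
      (Finset.Subset.refl A)
    rw [Finset.toList_toFinset] at h2
    have h3 : cutExp v C⁻¹ (K * C / 2) A = Real.exp (-(C⁻¹ * v A)) := if_pos hA
    rw [h3]
    refine (h1.trans h2).trans ?_
    rw [mul_comm]
    refine mul_le_mul_of_nonneg_right (Real.exp_le_exp.2 (neg_le_neg ?_)) (Real.exp_pos _).le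
    -- Below the cut-off level, `A` uses up at most `K * C / 2` of the value of `Q`.
    have h4 : K / 2 * (u + C) ≤ v (A ∪ Q) - v A := by
      have := hv.mono Q (A ∪ Q) Finset.subset_union_right
      nlinarith [mul_nonneg hK hu.le]
    -- From `e^(-z) ≤ 1 / (1 + z)` at `z = u / C`. This rate cancels the factor `u + C` gained in
    -- `h4`, whatever the item size.
    have h5 : (u + C)⁻¹ ≤ (1 - Real.exp (-(C⁻¹ * u))) / u := by
      rw [le_div_iff₀ hu]
      have h6 : Real.exp (-(C⁻¹ * u)) ≤ (C⁻¹ * u + 1)⁻¹ := by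
        rw [Real.exp_neg]
        exact inv_anti₀ (by positivity) (Real.add_one_le_exp _)
      have h7 : (C⁻¹ * u + 1)⁻¹ = 1 - (u + C)⁻¹ * u := by
        field_simp
        ring
      linarith
    have h8 : K / 2 ≤ (1 - Real.exp (-(C⁻¹ * u))) / u * (v (A ∪ Q) - v A) := by
      have h9 : 0 < u + C := by positivity
      calc K / 2 = (u + C)⁻¹ * (K / 2 * (u + C)) := by field_simp
        _ ≤ (1 - Real.exp (-(C⁻¹ * u))) / u * (v (A ∪ Q) - v A) :=
          mul_le_mul h5 h4 (by positivity) ((inv_pos.2 h9).le.trans h5)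
    have := mul_le_mul_of_nonneg_left h8 hp.1
    linarith
  · have h0 : cutExp v C⁻¹ (K * C / 2) A = 0 := if_neg hA
    have := sampleUnion_le_self hp (cutExp_antitone hv hθ (K * C / 2)) Q.toList A
    rw [h0] at this ⊢
    simpa using this

/-- The sets are peeled off one at a time. Since `hstep` holds for every starting set `A`, each
factor `q S` comes out of the expectation, although the values of the samples do not add up
independently. -/
theorem multilinearExt_sum_le_prod [Fintype M] {ι : Type*} [DecidableEq ι] {h : Finset M → ℝ}
    (hh : Antitone h) {y : ι → ℝ} (hy : ∀ S, 0 ≤ y S) (Q : ι → Finset M) {q : ι → ℝ}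
    (hq : ∀ S, 0 ≤ q S) (s : Finset ι) (hs : ∑ S ∈ s, y S ≤ 1)
    (hstep : ∀ S A, sampleUnion (y S) (Q S).toList h A ≤ q S * h A) :
    multilinearExt h (fun j => ∑ S ∈ s, if j ∈ Q S then y S else 0)
      ≤ (∏ S ∈ s, q S) * h ∅ := by
  induction s using Finset.induction_on with
  | empty =>
    rw [multilinearExt_indicator h ∅ (by simp) (by simp)]
    simp
  | insert T s hT ih =>
    rw [Finset.sum_insert hT] at hs
    have hy1 : y T ≤ 1 := by linarith [Finset.sum_nonneg fun S (_ : S ∈ s) => hy S]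
    have hs1 : ∑ S ∈ s, y S ≤ 1 := by linarith [hy T]
    have hle : ∀ j, (∑ S ∈ s, if j ∈ Q S then y S else 0) ≤ ∑ S ∈ s, y S := fun j =>
      Finset.sum_le_sum fun S _ => by
        split_ifs
        · exact le_rfl
        · exact hy S
    have h0 : ∀ j, 0 ≤ ∑ S ∈ s, if j ∈ Q S then y S else 0 := fun j =>
      Finset.sum_nonneg fun S _ => by
        split_ifs
        · exact hy S
        · exact le_rfl
    have e : (fun j => ∑ S ∈ insert T s, if j ∈ Q S then y S else 0)
        = fun j => (∑ S ∈ s, if j ∈ Q S then y S else 0)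
          + if j ∈ (Q T).toList then y T else 0 := by
      funext j
      rw [Finset.sum_insert hT, add_comm]
      simp only [Finset.mem_toList]
    rw [e]
    calc _ ≤ multilinearExt (sampleUnion (y T) (Q T).toList h)
            (fun j => ∑ S ∈ s, if j ∈ Q S then y S else 0) :=
          multilinearExt_add_le_sampleUnion hh ⟨hy T, hy1⟩ (Finset.nodup_toList _) h0 fun j => by
            have := hle j
            have h2 : (if j ∈ (Q T).toList then y T else 0) ≤ y T := by
              split_ifs
              · exact le_rfl
              · exact hy T
            linarith
      _ ≤ multilinearExt (fun A => q T * h A) (fun j => ∑ S ∈ s, if j ∈ Q S then y S else 0) :=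
          multilinearExt_mono (hstep T) fun j => ⟨h0 j, (hle j).trans hs1⟩
      _ = q T * multilinearExt h (fun j => ∑ S ∈ s, if j ∈ Q S then y S else 0) :=
          multilinearExt_const_mul _ _ _
      _ ≤ q T * ((∏ S ∈ s, q S) * h ∅) := mul_le_mul_of_nonneg_left (ih hs1) (hq T)
      _ = _ := by rw [Finset.prod_insert hT, mul_assoc]

/-- Lower-tail bound for an independent sample whose marginals are those of a random set `Q S`,
where `S` has probability `y S`: sets of total probability `∑ S ∈ s, y S` have value at least
`K * (u S + C)`, where `u S` bounds their single items. -/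
theorem multilinearExt_exp_neg_le [Fintype M] (hv : IsValuation v) {ι : Type*} [Fintype ι]
    [DecidableEq ι] {y : ι → ℝ} (hy : ∀ S, 0 ≤ y S) (hy1 : ∑ S, y S ≤ 1) (Q : ι → Finset M)
    {C K : ℝ} (hC : 0 < C) (hK : 0 ≤ K) (s : Finset ι) (u : ι → ℝ) (hu : ∀ S ∈ s, 0 < u S)
    (hQ : ∀ S ∈ s, ∀ j ∈ Q S, v {j} ≤ u S) (hval : ∀ S ∈ s, K * (u S + C) ≤ v (Q S)) :
    multilinearExt (fun A => Real.exp (-(C⁻¹ * v A))) (fun j => ∑ S, if j ∈ Q S then y S else 0)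
      ≤ Real.exp (-(K / 2 * ∑ S ∈ s, y S)) + Real.exp (-(K / 2)) := by
  have hθ : 0 ≤ C⁻¹ := (inv_pos.2 hC).le
  set h := cutExp v C⁻¹ (K * C / 2) with hh
  have hanti : Antitone h := cutExp_antitone hv hθ _
  have hle1 : ∀ S, y S ≤ 1 := fun S =>
    (Finset.single_le_sum (fun T _ => hy T) (Finset.mem_univ S)).trans hy1
  have hx : ∀ j, (∑ S, if j ∈ Q S then y S else 0) ∈ Set.Icc (0 : ℝ) 1 := fun j =>
    ⟨Finset.sum_nonneg fun S _ => by split_ifs; exacts [hy S, le_rfl],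
      (Finset.sum_le_sum fun S _ => by split_ifs; exacts [le_rfl, hy S]).trans hy1⟩
  -- The cut-off discards only values with `v A / C ≥ K / 2`.
  have h1 : ∀ A, Real.exp (-(C⁻¹ * v A)) ≤ h A + Real.exp (-(K / 2)) := by
    intro A
    by_cases hA : v A < K * C / 2
    · rw [hh, cutExp, if_pos hA]
      linarith [Real.exp_pos (-(K / 2))]
    · rw [hh, cutExp, if_neg hA, zero_add]
      refine Real.exp_le_exp.2 (neg_le_neg ?_)
      have := mul_le_mul_of_nonneg_left (not_lt.1 hA) hθ
      have e : C⁻¹ * (K * C / 2) = K / 2 := by field_simp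
      linarith
  have h2 := multilinearExt_mono h1 hx
  rw [multilinearExt_add, multilinearExt_const] at h2
  have h3 := multilinearExt_sum_le_prod hanti hy Q
    (q := fun S => if S ∈ s then Real.exp (-(K / 2 * y S)) else 1)
    (fun S => by split_ifs; exacts [(Real.exp_pos _).le, zero_le_one]) Finset.univ hy1
    (fun S A => by
      split_ifs with hS
      · exact sampleUnion_cutExp_le hv hC hK ⟨hy S, hle1 S⟩ (hu S hS) (hQ S hS) (hval S hS) A
      · rw [one_mul]
        exact sampleUnion_le_self ⟨hy S, hle1 S⟩ hanti _ A)
  have h4 : h ∅ ≤ 1 := (cutExp_le v _ _ ∅).trans (by simp [hv.empty])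
  have h5 : (∏ S, if S ∈ s then Real.exp (-(K / 2 * y S)) else 1)
      = Real.exp (-(K / 2 * ∑ S ∈ s, y S)) := by
    rw [Finset.prod_ite_mem, Finset.univ_inter, ← Real.exp_sum, Finset.mul_sum,
      Finset.sum_neg_distrib]
  rw [h5] at h3
  have h6 := mul_le_mul_of_nonneg_left h4 (Real.exp_pos (-(K / 2 * ∑ S ∈ s, y S))).le
  linarith

end Tail

/-! ### The rounding procedure -/

section Rounding

variable {N M : Type*}

theorem AltSeq.delta_pos_le {w : AltSeq N M} {x : Edge N M → ℝ} (hx : w.InFracSupp x)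
    (hw : 1 ≤ w.len) :
    (0 < w.delta₁ x ∧ ∀ a < w.len, w.delta₁ x ≤ x (w.fwd a) ∧ w.delta₁ x ≤ 1 - x (w.bwd a)) ∧
    (0 < w.delta₂ x ∧ ∀ a < w.len, w.delta₂ x ≤ 1 - x (w.fwd a) ∧ w.delta₂ x ≤ x (w.bwd a)) := by
  have : Nonempty (Fin w.len) := ⟨⟨0, hw⟩⟩
  refine ⟨⟨?_, fun a ha => ?_⟩, ?_, fun a ha => ?_⟩
  · obtain ⟨a, ha⟩ := exists_eq_ciInf_of_finite
      (f := fun a : Fin w.len => min (x (w.fwd a)) (1 - x (w.bwd a)))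
    rw [AltSeq.delta₁, ← ha]
    exact lt_min (hx a a.2).1.1 (sub_pos.2 (hx a a.2).2.2)
  · exact le_min_iff.1 (ciInf_le (f := fun a : Fin w.len => min (x (w.fwd a)) (1 - x (w.bwd a)))
      (Set.finite_range _).bddBelow ⟨a, ha⟩)
  · obtain ⟨a, ha⟩ := exists_eq_ciInf_of_finite
      (f := fun a : Fin w.len => min (1 - x (w.fwd a)) (x (w.bwd a)))
    rw [AltSeq.delta₂, ← ha]
    exact lt_min (sub_pos.2 (hx a a.2).1.2) (hx a a.2).2.1
  · exact le_min_iff.1 (ciInf_le (f := fun a : Fin w.len => min (1 - x (w.fwd a)) (x (w.bwd a)))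
      (Set.finite_range _).bddBelow ⟨a, ha⟩)

theorem AltSeq.one_le_len {w : AltSeq N M} (hw : w.IsMarkedCycle ∨ w.IsPseudoMarkedPath) :
    1 ≤ w.len := by
  rcases hw with h | h
  · exact (by norm_num : 1 ≤ 2).trans h.2.1
  · exact h.2.1

theorem measurable_comp_smallAssigned [Fintype N] [Fintype M] (i : N) (f : Finset M → ENNReal) :
    Measurable fun X : Edge N M → ℝ => f (smallAssigned i X) := by
  let _ : MeasurableSpace (Finset M) := ⊤
  have h : Measurable (smallAssigned i : (Edge N M → ℝ) → Finset M) := by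
    refine measurable_to_countable' fun A => ?_
    have e : smallAssigned i ⁻¹' {A}
        = ⋂ j : M, {X : Edge N M → ℝ | X (i, j, false) = 1 ↔ j ∈ A} := by
      ext X
      simp [smallAssigned, Finset.ext_iff]
    rw [e]
    refine MeasurableSet.iInter fun j => ?_
    have hm : MeasurableSet {X : Edge N M → ℝ | X (i, j, false) = 1} :=
      (measurable_pi_apply (i, j, false)) (measurableSet_singleton 1)
    exact hm.iff (MeasurableSet.const _)
  exact measurable_from_top.comp h

variable [DecidableEq N] [DecidableEq M]

theorem AltSeq.shift_unmarked_of_cycle {w : AltSeq N M} (hw : w.IsMarkedCycle)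
    (x : Edge N M → ℝ) (d : ℝ) (i : N) (j : M) :
    w.shift x d (i, j, false) = x (i, j, false) := by
  simp [AltSeq.shift, AltSeq.fwd, AltSeq.bwd, hw.1]

theorem AltSeq.shift_unmarked_of_path {w : AltSeq N M} (hw : w.IsPseudoMarkedPath)
    (x : Edge N M → ℝ) (d : ℝ) (i : N) (j : M) :
    w.shift x d (i, j, false) = x (i, j, false)
      - (if w.fwd 0 = (i, j, false) then d else 0)
      + if w.bwd (w.len - 1) = (i, j, false) then d else 0 := by
  have hlen := hw.2.1
  have h1 : (∑ a ∈ Finset.range w.len, if w.fwd a = (i, j, false) then d else 0)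
      = if w.fwd 0 = (i, j, false) then d else 0 := by
    refine Finset.sum_eq_single_of_mem 0 (Finset.mem_range.2 hlen) fun a _ ha => ?_
    rw [if_neg]
    simp [AltSeq.fwd, hw.1, ha]
  have h2 : (∑ a ∈ Finset.range w.len, if w.bwd a = (i, j, false) then d else 0)
      = if w.bwd (w.len - 1) = (i, j, false) then d else 0 := by
    refine Finset.sum_eq_single_of_mem (w.len - 1) (Finset.mem_range.2 (by omega))
      fun a ha hne => ?_
    rw [if_neg]
    have := Finset.mem_range.1 ha
    simp only [AltSeq.bwd, hw.1, Bool.false_or, Prod.mk.injEq, decide_eq_false_iff_not]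
    omega
  rw [AltSeq.shift, h1, h2]

theorem AltSeq.shift_unmarked_mem_Icc {w : AltSeq N M}
    (hw : w.IsMarkedCycle ∨ w.IsPseudoMarkedPath) {x : Edge N M → ℝ} (hx : w.InFracSupp x)
    {i : N} {j : M} (hxi : x (i, j, false) ∈ Set.Icc (0 : ℝ) 1) :
    w.shift x (w.delta₁ x) (i, j, false) ∈ Set.Icc (0 : ℝ) 1 ∧
      w.shift x (-w.delta₂ x) (i, j, false) ∈ Set.Icc (0 : ℝ) 1 := by
  obtain ⟨⟨p1, b1⟩, p2, b2⟩ := AltSeq.delta_pos_le hx (AltSeq.one_le_len hw)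
  rcases hw with hw | hw
  · simp only [AltSeq.shift_unmarked_of_cycle hw]
    exact ⟨hxi, hxi⟩
  · have hlen := hw.2.1
    simp only [AltSeq.shift_unmarked_of_path hw]
    have f1 := (b1 0 hlen).1
    have f2 := (b2 0 hlen).1
    have g1 := (b1 (w.len - 1) (by omega)).2
    have g2 := (b2 (w.len - 1) (by omega)).2
    have hne := hw.2.2.2.2
    obtain ⟨l, r⟩ := hxi
    by_cases hf : w.fwd 0 = (i, j, false)
    · have hb : w.bwd (w.len - 1) ≠ (i, j, false) := fun h => hne (hf.trans h.symm)
      rw [hf] at f1 f2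
      simp only [if_pos hf, if_neg hb]
      constructor <;> constructor <;> linarith
    · by_cases hb : w.bwd (w.len - 1) = (i, j, false)
      · rw [hb] at g1 g2
        simp only [if_neg hf, if_pos hb]
        constructor <;> constructor <;> linarith
      · simp only [if_neg hf, if_neg hb]
        constructor <;> constructor <;> linarith

/-- Only the two end edges of a path are unmarked. If both belong to `i`, their items differ and the
move is along `e_b - e_a`. If only one does, the extension is affine in that coordinate. Otherwise
the row of `i` does not change. -/
theorem AltSeq.multilinearExt_shift_le [Fintype M] {w : AltSeq N M}
    (hw : w.IsMarkedCycle ∨ w.IsPseudoMarkedPath) {x : Edge N M → ℝ} {i : N}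
    (hxi : ∀ j, x (i, j, false) ∈ Set.Icc (0 : ℝ) 1) {g : Finset M → ℝ}
    (hg : ∀ S T, g S + g T ≤ g (S ∪ T) + g (S ∩ T)) {p q d d' : ℝ}
    (hp : 0 ≤ p) (hq : 0 ≤ q) (hpq : p + q = 1) (hd : p * d = q * d') :
    p * multilinearExt g (fun j => w.shift x d (i, j, false))
      + q * multilinearExt g (fun j => w.shift x (-d') (i, j, false))
      ≤ multilinearExt g (fun j => x (i, j, false)) := by
  rcases hw with hw | hw
  · simp only [AltSeq.shift_unmarked_of_cycle hw]
    rw [← add_mul, hpq, one_mul]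
  set z : M → ℝ := fun j => x (i, j, false) with hz
  have hrow : ∀ d : ℝ, (fun j => w.shift x d (i, j, false)) = fun j => z j
      - (if w.fwd 0 = (i, j, false) then d else 0)
      + if w.bwd (w.len - 1) = (i, j, false) then d else 0 := fun d =>
    funext fun j => AltSeq.shift_unmarked_of_path hw x d i j
  simp only [hrow]
  have hne := hw.2.2.2.2
  have hlen : w.len - 1 + 1 = w.len := by have := hw.2.1; omega
  have hfwd : ∀ j, w.fwd 0 = (i, j, false) ↔ w.agent 0 = i ∧ w.item 0 = j := fun j => by
    simp [AltSeq.fwd, hw.1]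
  have hbwd : ∀ j, w.bwd (w.len - 1) = (i, j, false) ↔
      w.agent w.len = i ∧ w.item (w.len - 1) = j := fun j => by
    simp [AltSeq.bwd, hw.1, hlen]
  by_cases hf : w.agent 0 = i
  · by_cases hb : w.agent w.len = i
    · have hab : w.item 0 ≠ w.item (w.len - 1) := fun h =>
        hne (((hfwd _).2 ⟨hf, rfl⟩).trans ((hbwd _).2 ⟨hb, h.symm⟩).symm)
      have e : ∀ d : ℝ, (fun j => z j - (if w.fwd 0 = (i, j, false) then d else 0)
          + if w.bwd (w.len - 1) = (i, j, false) then d else 0)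
          = Function.update (Function.update z (w.item 0) (z (w.item 0) - d))
            (w.item (w.len - 1)) (z (w.item (w.len - 1)) + d) := by
        intro d
        funext j
        simp only [hfwd, hbwd, hf, hb, true_and]
        by_cases h1 : j = w.item (w.len - 1)
        · subst h1
          simp [hab]
        · by_cases h2 : j = w.item 0
          · subst h2
            simp [hab, hab.symm]
          · simp [h1, h2, Ne.symm h1, Ne.symm h2]
      rw [e, e]
      simpa only [sub_neg_eq_add, ← sub_eq_add_neg] using
        multilinearExt_exchange_le hg hxi hab hp hq hpq hd
    · have e : ∀ d : ℝ, (fun j => z j - (if w.fwd 0 = (i, j, false) then d else 0)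
          + if w.bwd (w.len - 1) = (i, j, false) then d else 0)
          = Function.update z (w.item 0) (z (w.item 0) - d) := by
        intro d
        funext j
        simp only [hfwd, hbwd, hf, hb, true_and, false_and, if_false, add_zero]
        by_cases h2 : j = w.item 0
        · subst h2
          simp
        · simp [h2, Ne.symm h2]
      rw [e, e, sub_neg_eq_add]
      exact (multilinearExt_single_eq g z _ hpq hd).le
  · by_cases hb : w.agent w.len = i
    · have e : ∀ d : ℝ, (fun j => z j - (if w.fwd 0 = (i, j, false) then d else 0)
          + if w.bwd (w.len - 1) = (i, j, false) then d else 0)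
          = Function.update z (w.item (w.len - 1)) (z (w.item (w.len - 1)) - -d) := by
        intro d
        funext j
        simp only [hfwd, hbwd, hf, hb, true_and, false_and, if_false, sub_zero]
        by_cases h2 : j = w.item (w.len - 1)
        · subst h2
          simp
        · simp [h2, Ne.symm h2]
      rw [e, e]
      have := multilinearExt_single_eq g z (w.item (w.len - 1)) (d := -d) (d' := -d') hpq
        (by linarith)
      simpa only [neg_neg, sub_eq_add_neg] using this.le
    · simp only [hfwd, hbwd, hf, hb, false_and, if_false, sub_zero, add_zero]
      rw [← add_mul, hpq, one_mul]

theorem IsRoundingLaw.measure_univ {x : Edge N M → ℝ} {μ : Measure (Edge N M → ℝ)}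
    (h : IsRoundingLaw x μ) : μ Set.univ = 1 := by
  induction h with
  | done x hx => simp
  | step x w hw hx μ₁ μ₂ h₁ h₂ ih₁ ih₂ =>
    obtain ⟨⟨p1, -⟩, p2, -⟩ := AltSeq.delta_pos_le hx (AltSeq.one_le_len hw)
    simp only [Measure.add_apply, Measure.smul_apply, ih₁, ih₂, smul_eq_mul, mul_one]
    rw [← ENNReal.ofReal_add (by positivity) (by positivity), ← add_div, add_comm,
      div_self (by positivity), ENNReal.ofReal_one]
  | randomize x ι q μ h ih =>
    simp [Measure.sum_apply, ih, q.tsum_coe]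

/-- For a supermodular function of the small items of an agent, rounding is at least as good as
independent sampling. -/
theorem IsRoundingLaw.lintegral_le [Fintype N] [Fintype M] {x : Edge N M → ℝ}
    {μ : Measure (Edge N M → ℝ)} (h : IsRoundingLaw x μ) {i : N} {g : Finset M → ℝ}
    (hg0 : ∀ A, 0 ≤ g A) (hg : ∀ S T, g S + g T ≤ g (S ∪ T) + g (S ∩ T))
    (hx : ∀ j, x (i, j, false) ∈ Set.Icc (0 : ℝ) 1) :
    ∫⁻ X, ENNReal.ofReal (g (smallAssigned i X)) ∂μ
      ≤ ENNReal.ofReal (multilinearExt g fun j => x (i, j, false)) := by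
  have hnn : ∀ z : M → ℝ, (∀ j, z j ∈ Set.Icc (0 : ℝ) 1) → 0 ≤ multilinearExt g z :=
    fun z hz => (multilinearExt_const 0 z).symm.le.trans (multilinearExt_mono hg0 hz)
  induction h with
  | done x hx01 =>
    rw [lintegral_dirac' _ (measurable_comp_smallAssigned i fun A => ENNReal.ofReal (g A)),
      multilinearExt_indicator g (smallAssigned i x)]
    · simp [smallAssigned]
    · intro j hj
      refine (hx01 _).resolve_right fun h => hj ?_
      simpa [smallAssigned] using h
  | step x w hw hfr μ₁ μ₂ h₁ h₂ ih₁ ih₂ =>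
    obtain ⟨⟨p1, -⟩, p2, -⟩ := AltSeq.delta_pos_le hfr (AltSeq.one_le_len hw)
    have hI := fun j => AltSeq.shift_unmarked_mem_Icc hw hfr (hx j)
    have hp : 0 ≤ w.delta₂ x / (w.delta₁ x + w.delta₂ x) := by positivity
    have hq : 0 ≤ w.delta₁ x / (w.delta₁ x + w.delta₂ x) := by positivity
    rw [lintegral_add_measure, lintegral_smul_measure, lintegral_smul_measure, smul_eq_mul,
      smul_eq_mul]
    refine (add_le_add (mul_le_mul_right (ih₁ fun j => (hI j).1) _)
      (mul_le_mul_right (ih₂ fun j => (hI j).2) _)).trans ?_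
    rw [← ENNReal.ofReal_mul hp, ← ENNReal.ofReal_mul hq,
      ← ENNReal.ofReal_add (mul_nonneg hp (hnn _ fun j => (hI j).1))
        (mul_nonneg hq (hnn _ fun j => (hI j).2))]
    refine ENNReal.ofReal_le_ofReal (AltSeq.multilinearExt_shift_le hw hx hg hp hq ?_ ?_)
    · field_simp
      ring
    · field_simp
  | randomize x ι q μ h ih =>
    rw [lintegral_sum_measure]
    calc ∑' a, ∫⁻ X, ENNReal.ofReal (g (smallAssigned i X)) ∂(q a • μ a)
        ≤ ∑' a, q a * ENNReal.ofReal (multilinearExt g fun j => x (i, j, false)) := by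
          refine ENNReal.tsum_le_tsum fun a => ?_
          rw [lintegral_smul_measure, smul_eq_mul]
          exact mul_le_mul_right (ih a hx) _
      _ = _ := by rw [ENNReal.tsum_mul_right, q.tsum_coe, one_mul]

end Rounding

/-! ### Logarithms and quantiles -/

theorem ln_mono {a b : ℝ} (h : a ≤ b) : ln a ≤ ln b :=
  ENNReal.log_monotone (ENNReal.ofReal_le_ofReal h)

theorem exp_mul_lt_of_ln_lt {a b lam : ℝ} (ha : 0 ≤ a) (h : ln a + (lam : EReal) < ln b) :
    Real.exp lam * a < b := by
  have e : (lam : EReal) = ENNReal.log (ENNReal.ofReal (Real.exp lam)) := by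
    rw [ENNReal.log_ofReal_of_pos (Real.exp_pos lam), Real.log_exp]
  rw [e, ln, ln, ← ENNReal.log_mul_add, ENNReal.log_strictMono.lt_iff_lt,
    ← ENNReal.ofReal_mul ha, ENNReal.ofReal_lt_ofReal_iff_of_nonneg (by positivity)] at h
  linarith

section Quantile

variable {N M : Type*} [Fintype M]

theorem bddAbove_quantileSet {v : Finset M → ℝ} (μ : Measure (Edge N M → ℝ)) (i : N)
    {t : ℝ} (ht : 0 < t) :
    BddAbove {A : ℝ | ENNReal.ofReal t ≤ μ {X | A ≤ v (smallAssigned i X)}} := by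
  obtain ⟨c, hc⟩ := (Set.finite_range v).bddAbove
  refine ⟨c, fun A hA => ?_⟩
  by_contra! hlt
  have h0 : {X : Edge N M → ℝ | A ≤ v (smallAssigned i X)} = ∅ :=
    Set.eq_empty_of_forall_notMem fun X hX =>
      (hX.trans (hc ⟨smallAssigned i X, rfl⟩)).not_gt hlt
  simp only [Set.mem_ofPred_eq, h0, measure_empty, nonpos_iff_eq_zero,
    ENNReal.ofReal_eq_zero] at hA
  exact hA.not_gt ht

variable {v : Finset M → ℝ} {μ : Measure (Edge N M → ℝ)}

theorem zero_mem_quantileSet (hv : ∀ S, 0 ≤ v S) (hμ : μ Set.univ = 1) (i : N) {t : ℝ}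
    (ht : t ≤ 1) : (0 : ℝ) ∈ {A : ℝ | ENNReal.ofReal t ≤ μ {X | A ≤ v (smallAssigned i X)}} := by
  have h : {X : Edge N M → ℝ | 0 ≤ v (smallAssigned i X)} = Set.univ :=
    Set.eq_univ_of_forall fun X => hv _
  rw [Set.mem_ofPred_eq, h, hμ]
  exact ENNReal.ofReal_le_one.2 ht

theorem outputQuantilePos_nonneg (hv : ∀ S, 0 ≤ v S) (hμ : μ Set.univ = 1) (i : N) {t : ℝ}
    (ht0 : 0 < t) (ht : t ≤ 1) : 0 ≤ outputQuantilePos v μ i t :=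
  le_csSup (bddAbove_quantileSet μ i ht0) (zero_mem_quantileSet hv hμ i ht)

theorem outputQuantilePos_anti (hv : ∀ S, 0 ≤ v S) (hμ : μ Set.univ = 1) (i : N) {s t : ℝ}
    (hs : 0 < s) (hst : s ≤ t) (ht : t ≤ 1) :
    outputQuantilePos v μ i t ≤ outputQuantilePos v μ i s :=
  csSup_le_csSup (bddAbove_quantileSet μ i hs) ⟨0, zero_mem_quantileSet hv hμ i ht⟩
    fun _ hA => (ENNReal.ofReal_le_ofReal hst).trans hA

/-- Strictness of `hC` keeps `C` out of the set whose supremum is the quantile, so the supremum need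
not be attained. -/
theorem ofReal_one_sub_le_measure_lt (hμ : μ Set.univ = 1) (i : N) {s C : ℝ} (hs : 0 < s)
    (hC : outputQuantilePos v μ i s < C) :
    ENNReal.ofReal (1 - s) ≤ μ {X | v (smallAssigned i X) < C} := by
  have h1 : μ {X | C ≤ v (smallAssigned i X)} ≤ ENNReal.ofReal s := by
    by_contra! h
    exact (le_csSup (bddAbove_quantileSet μ i hs) h.le).not_gt hC
  have h2 : (1 : ENNReal) ≤ μ {X | v (smallAssigned i X) < C} + ENNReal.ofReal s := by
    rw [← hμ]
    refine (measure_mono fun X _ => ?_).trans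
      ((measure_union_le _ _).trans (add_le_add_right h1 _))
    exact lt_or_ge (v (smallAssigned i X)) C
  rw [ENNReal.ofReal_sub _ hs.le, ENNReal.ofReal_one]
  exact tsub_le_iff_right.2 h2

end Quantile

/-! ### The sorted list of configurations -/

section Configs

variable {M : Type*}

theorem measurableSet_configAt_eq (y : Finset M → ℝ) (L : List (Finset M)) (S : Finset M) :
    MeasurableSet {t | configAt y L t = S} := by
  induction L with
  | nil =>
    simp only [configAt]
    exact MeasurableSet.const _
  | cons T L ih =>
    have e : {t | configAt y (T :: L) t = S}
        = ({t | t ≤ y T} ∩ {_t | T = S}) ∪ ({t | t ≤ y T}ᶜ ∩ (fun t => t - y T) ⁻¹'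
          {t | configAt y L t = S}) := by
      ext t
      by_cases h : t ≤ y T <;> simp [configAt, h]
    rw [e]
    exact (measurableSet_Iic.inter (MeasurableSet.const _)).union
      (measurableSet_Iic.compl.inter ((measurable_id.sub_const _) ih))

-- Each listed set occupies an interval of length `y S`. The condition `t ≤ (L.map y).sum` excludes
-- the positions where `configAt` falls through to its default `∅`.
open Classical in
theorem volume_configAt_le {y : Finset M → ℝ} (hy : ∀ S, 0 ≤ y S) (P : Finset M → Prop)
    (L : List (Finset M)) :
    volume {t | 0 < t ∧ t ≤ (L.map y).sum ∧ P (configAt y L t)}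
      ≤ ENNReal.ofReal ((L.filter P).map y).sum := by
  induction L with
  | nil =>
    have : {t : ℝ | 0 < t ∧ t ≤ (([] : List (Finset M)).map y).sum ∧ P (configAt y [] t)} = ∅ :=
      Set.eq_empty_of_forall_notMem fun t ht => ht.1.not_ge (by simpa using ht.2.1)
    rw [this, measure_empty]
    exact zero_le
  | cons T L ih =>
    have hsum : 0 ≤ ((L.filter P).map y).sum := List.sum_nonneg fun a ha => by
      obtain ⟨S, -, rfl⟩ := List.mem_map.1 ha
      exact hy S
    set tail := {t | 0 < t ∧ t ≤ (L.map y).sum ∧ P (configAt y L t)} with htail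
    have hsub : {t | 0 < t ∧ t ≤ ((T :: L).map y).sum ∧ P (configAt y (T :: L) t)}
        ⊆ (Set.Ioc 0 (y T) ∩ {_t | P T}) ∪ (fun t => t - y T) ⁻¹' tail := by
      rintro t ⟨h0, h1, h2⟩
      by_cases h : t ≤ y T
      · rw [configAt, if_pos h] at h2
        exact Or.inl ⟨⟨h0, h⟩, h2⟩
      · rw [configAt, if_neg h] at h2
        rw [List.map_cons, List.sum_cons] at h1
        exact Or.inr ⟨sub_pos.2 (not_le.1 h), by linarith, h2⟩
    have hpre : volume ((fun t => t - y T) ⁻¹' tail) = volume tail := by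
      simpa only [sub_eq_add_neg] using measure_preimage_add_right volume (-y T) tail
    refine (measure_mono hsub).trans ((measure_union_le _ _).trans ?_)
    rw [hpre]
    by_cases hT : P T
    · rw [List.filter_cons_of_pos (by simpa using hT), List.map_cons, List.sum_cons,
        ENNReal.ofReal_add (hy T) hsum]
      refine add_le_add ((measure_mono Set.inter_subset_left).trans ?_) ih
      rw [Real.volume_Ioc, sub_zero]
    · rw [List.filter_cons_of_neg (by simpa using hT)]
      simpa [hT] using ih

variable {v y : Finset M → ℝ} {κ : Finset M → M} {L : List (Finset M)}

open Classical in
theorem IsSortedConfigs.sum_filter [Fintype M] (hL : IsSortedConfigs v y κ L)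
    (P : Finset M → Prop) :
    ((L.filter P).map y).sum = ∑ S with 0 < y S ∧ P S, y S := by
  rw [← List.sum_toFinset y (hL.nodup.filter _)]
  refine Finset.sum_congr ?_ fun _ _ => rfl
  ext S
  simp [hL.mem_iff]

theorem IsSortedConfigs.sum_eq_one [Fintype M] (hL : IsSortedConfigs v y κ L)
    (hy : ∀ S, 0 ≤ y S) (hy1 : ∑ S, y S = 1) : (L.map y).sum = 1 := by
  classical
  have h := hL.sum_filter fun _ => True
  simp only [decide_true, List.filter_true, and_true] at h
  rw [h, ← hy1]
  refine Finset.sum_subset (Finset.subset_univ _) fun S _ hS => ?_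
  refine le_antisymm (not_lt.1 fun h => hS ?_) (hy S)
  simpa using h

end Configs

/-! ### The exceptional set -/

section Main

variable {N M : Type*} [Fintype M] [DecidableEq M]

theorem measurableSet_badSet {v : Finset M → ℝ} (hv : ∀ S, 0 ≤ v S) (y : Finset M → ℝ)
    (κ : Finset M → M) (L : List (Finset M)) {μ : Measure (Edge N M → ℝ)}
    (hμ : μ Set.univ = 1) (i : N) (lam : ℝ) : MeasurableSet (badSet v y κ L μ i lam) := by
  -- Isolating the point `0` avoids the limit that defines `C_0`. On the rest the configuration is
  -- fixed piecewise.
  have e : badSet v y κ L μ i lam = (badSet v y κ L μ i lam ∩ {0}) ∪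
      ⋃ S : Finset M, {t | configAt y L t = S} ∩ {t | t ∈ Set.Ioc (0 : ℝ) 1 ∧
        ln (v {κ S} + outputQuantilePos v μ i t) + (lam : EReal) < ln (v (S.erase (κ S)))} := by
    ext t
    rcases eq_or_ne t 0 with rfl | ht
    · simp
    · simp only [badSet, smallValue, largeValue, outputQuantile, Set.mem_union,
        Set.mem_inter_iff, Set.mem_singleton_iff, ht, and_false, false_or, Set.mem_iUnion,
        Set.mem_ofPred_eq, exists_eq_left', Set.mem_Icc, Set.mem_Ioc, gt_iff_lt]
      refine and_congr_left fun _ => and_congr_left fun _ => ?_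
      exact ⟨fun h => lt_of_le_of_ne h ht.symm, le_of_lt⟩
  rw [e]
  refine MeasurableSet.union (Set.Finite.measurableSet ((Set.finite_singleton 0).inter_of_right _))
    (MeasurableSet.iUnion fun S => (measurableSet_configAt_eq y L S).inter ?_)
  -- For a fixed `S` the quantile is decreasing in `t`, so the strict inequality propagates upwards
  -- within `(0, 1]` and cuts out an interval.
  refine Set.OrdConnected.measurableSet ⟨?_⟩
  rintro s ⟨hs, hs'⟩ t ⟨ht, -⟩ r ⟨hsr, hrt⟩
  refine ⟨⟨hs.1.trans_le hsr, hrt.trans ht.2⟩, lt_of_le_of_lt ?_ hs'⟩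
  exact add_le_add_left (ln_mono (add_le_add_right
    (outputQuantilePos_anti hv hμ i hs.1 hsr (hrt.trans ht.2)) _)) _

theorem xStar_unmarked (y : N → Finset M → ℝ) (κ : N → Finset M → M) (i : N) (j : M) :
    xStar y κ (i, j, false) = ∑ S, if j ∈ S.erase (κ i S) then y i S else 0 := by
  simp only [xStar, Bool.false_eq_true, if_false]
  rw [Finset.sum_filter]

/-- The chord of `exp` over `[0, 5/2]` has slope at most `(16 - 1) / (5/2) = 6`. -/
theorem exp_le_six_mul_add_one {lam : ℝ} (h0 : 0 ≤ lam) (h : lam ≤ 5 / 2) :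
    Real.exp lam ≤ 6 * lam + 1 := by
  have hc := convexOn_exp.2 (Set.mem_univ (5 / 2)) (Set.mem_univ 0)
    (by positivity : 0 ≤ lam / (5 / 2)) (sub_nonneg.2 ((div_le_one (by norm_num)).2 h))
    (add_sub_cancel (lam / (5 / 2)) 1)
  simp only [smul_eq_mul, mul_zero, add_zero, Real.exp_zero, mul_one] at hc
  rw [div_mul_cancel₀ _ (by norm_num)] at hc
  have h52 : Real.exp (5 / 2) ≤ 16 := by
    have h1 : Real.exp (5 / 2) ≤ Real.exp 1 ^ 3 := by
      rw [← Real.exp_nat_mul]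
      exact Real.exp_le_exp.2 (by norm_num)
    have h2 : Real.exp (5 / 2) * Real.exp (5 / 2) = Real.exp 1 ^ 5 := by
      rw [← Real.exp_add, ← Real.exp_nat_mul]
      norm_num
    have h3 : Real.exp 1 ^ 5 ≤ (2.72 : ℝ) ^ 5 :=
      pow_le_pow_left₀ (Real.exp_pos 1).le (Real.exp_one_lt_d9.le.trans (by norm_num)) 5
    nlinarith [Real.exp_pos (5 / 2)]
  nlinarith

theorem two_mul_add_four_le_exp {lam : ℝ} (h : 5 / 2 ≤ lam) : 2 * (lam + 2) ≤ Real.exp lam := by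
  have h1 : Real.exp lam = Real.exp 1 ^ 2 * Real.exp (lam - 2) := by
    rw [← Real.exp_nat_mul, ← Real.exp_add]
    congr 1
    norm_num
  have h2 : (2.7 : ℝ) ^ 2 ≤ Real.exp 1 ^ 2 :=
    pow_le_pow_left₀ (by norm_num) (Real.exp_one_gt_d9.le.trans' (by norm_num)) 2
  have h3 := Real.quadratic_le_exp_of_nonneg (by linarith : 0 ≤ lam - 2)
  nlinarith

/-- The configurations that are much more valuable than their largest item and the output have
small total weight. -/
theorem sum_badConfigs_le [Fintype N] [DecidableEq N] {v : N → Finset M → ℝ} {i : N}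
    (hv : IsValuation (v i)) {y : N → Finset M → ℝ} (hy : ∀ S, 0 ≤ y i S)
    (hy1 : ∑ S, y i S = 1) {κ : N → Finset M → M} (hκ : IsLargestItem v y κ)
    {μ : Measure (Edge N M → ℝ)} (hμ : IsRoundingLaw (xStar y κ) μ) {lam : ℝ}
    (hlam : 5 / 2 ≤ lam) (B : Finset (Finset M)) (hB : ∀ S ∈ B, 0 < y i S ∧
      Real.exp lam * (v i {κ i S} + outputQuantilePos (v i) μ i (1 - Real.exp (-lam)))
        < v i (S.erase (κ i S))) :
    ∑ S ∈ B, y i S ≤ 6 * lam * Real.exp (-lam) := by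
  have hneg : Real.exp (-lam) < 1 := Real.exp_lt_one_iff.2 (by linarith)
  have hs0 : 0 < 1 - Real.exp (-lam) := sub_pos.2 hneg
  have hs1 : 1 - Real.exp (-lam) ≤ 1 := by linarith [Real.exp_pos (-lam)]
  have huniv := hμ.measure_univ
  set c := outputQuantilePos (v i) μ i (1 - Real.exp (-lam)) with hc
  have hc0 : 0 ≤ c := outputQuantilePos_nonneg hv.nonneg huniv i hs0 hs1
  rcases B.eq_empty_or_nonempty with rfl | hne
  · rw [Finset.sum_empty]
    positivity
  -- `C` is the largest number with `e^lam * (u_S + C) ≤ v (Q S)` for all `S ∈ B`. As `B` is finite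
  -- and its inequalities are strict, `C` exceeds the quantile `c`.
  obtain ⟨S₀, hS₀, hmin⟩ := B.exists_min_image
    (fun S => v i (S.erase (κ i S)) / Real.exp lam - v i {κ i S}) hne
  set C := v i (S₀.erase (κ i S₀)) / Real.exp lam - v i {κ i S₀} with hCdef
  have hcC : c < C := by
    have := (lt_div_iff₀' (Real.exp_pos lam)).2 (hB S₀ hS₀).2
    linarith
  have hC : 0 < C := hc0.trans_lt hcC
  have hval : ∀ S ∈ B, Real.exp lam * (v i {κ i S} + C) ≤ v i (S.erase (κ i S)) := fun S hS => by
    rw [← le_div_iff₀' (Real.exp_pos lam)]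
    linarith [hmin S hS]
  have hitem : ∀ S ∈ B, ∀ j ∈ S.erase (κ i S), v i {j} ≤ v i {κ i S} := fun S hS j hj =>
    (hκ i S (hB S hS).1).2 j (Finset.mem_of_mem_erase hj)
  -- If the largest item were worthless, the whole small part would be, against `hval` and `C > 0`.
  have hu : ∀ S ∈ B, 0 < v i {κ i S} := fun S hS => by
    refine lt_of_le_of_ne (hv.nonneg _) fun h0 => ?_
    have h1 := hv.eq_zero_of_singletons fun j hj => (hitem S hS j hj).trans h0.symm.le
    have h2 := hval S hS
    rw [h1, ← h0, zero_add] at h2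
    exact h2.not_gt (by positivity)
  have htail := multilinearExt_exp_neg_le hv hy hy1.le (fun S => S.erase (κ i S)) hC
    (Real.exp_pos lam).le B (fun S => v i {κ i S}) hu hitem hval
  have hC' : 0 ≤ C⁻¹ := (inv_pos.2 hC).le
  have hround := hμ.lintegral_le (i := i) (fun A => (Real.exp_pos (-(C⁻¹ * v i A))).le)
    (hv.exp_neg_supermodular hC') (fun j => by
      rw [xStar_unmarked]
      exact ⟨Finset.sum_nonneg fun S _ => by split_ifs; exacts [hy S, le_rfl],
        (Finset.sum_le_sum fun S _ => by split_ifs; exacts [le_rfl, hy S]).trans hy1.le⟩)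
  simp only [xStar_unmarked] at hround
  -- Markov's inequality at level `e^(-1)`, which `exp (-v/C)` reaches wherever `v < C`.
  have hmarkov := mul_meas_ge_le_lintegral (μ := μ)
    (measurable_comp_smallAssigned i fun A => ENNReal.ofReal (Real.exp (-(C⁻¹ * v i A))))
    (ENNReal.ofReal (Real.exp (-1)))
  have hprob := ofReal_one_sub_le_measure_lt huniv i hs0 hcC
  rw [sub_sub_cancel] at hprob
  have hsub : {X : Edge N M → ℝ | v i (smallAssigned i X) < C} ⊆
      {X | ENNReal.ofReal (Real.exp (-1))
        ≤ ENNReal.ofReal (Real.exp (-(C⁻¹ * v i (smallAssigned i X))))} := fun X hX => by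
    refine ENNReal.ofReal_le_ofReal (Real.exp_le_exp.2 (neg_le_neg ?_))
    rw [inv_mul_le_iff₀ hC, mul_one]
    exact le_of_lt hX
  have hmain := (mul_le_mul_right (hprob.trans (measure_mono hsub)) _).trans
    (hmarkov.trans (hround.trans (ENNReal.ofReal_le_ofReal htail)))
  rw [← ENNReal.ofReal_mul (Real.exp_pos _).le, ENNReal.ofReal_le_ofReal_iff (by positivity),
    ← Real.exp_add] at hmain
  have hsmall : Real.exp (-(Real.exp lam / 2)) ≤ Real.exp (-1 + -lam) * Real.exp (-1) := by
    rw [← Real.exp_add]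
    exact Real.exp_le_exp.2 (by linarith [two_mul_add_four_le_exp hlam])
  have hhalf : Real.exp (-1) ≤ 1 / 2 := by
    rw [Real.exp_neg, one_div]
    exact inv_anti₀ (by norm_num) (Real.exp_one_gt_d9.le.trans' (by norm_num))
  -- The error term takes at most the fraction `e^(-1) ≤ 1/2` of `e^(-1-lam)`, so at least the
  -- fraction `e^(-1)` is left for the main term.
  have hexp : Real.exp (-1 + -lam + -1)
      ≤ Real.exp (-(Real.exp lam / 2 * ∑ S ∈ B, y i S)) := by
    rw [Real.exp_add]
    nlinarith [Real.exp_pos (-1 + -lam)]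
  have hlin := Real.exp_le_exp.1 hexp
  -- Uses `2 * (lam + 2) ≤ 6 * lam`, valid since `lam ≥ 1`.
  have hfin : Real.exp lam * ∑ S ∈ B, y i S ≤ 6 * lam := by linarith
  rw [Real.exp_neg, ← div_eq_mul_inv, le_div_iff₀' (Real.exp_pos lam)]
  exact hfin

end Main

end NashWelfare

end

theorem mainTheorem4 {N M : Type*} [Fintype N] [DecidableEq N] [Fintype M] [DecidableEq M]
    (v : N → Finset M → ℝ) (hv : ∀ i, NashWelfare.IsValuation (v i))
    (y : N → Finset M → ℝ) (hy : NashWelfare.IsConfLPFeasible y)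
    (κ : N → Finset M → M) (hκ : NashWelfare.IsLargestItem v y κ)
    (μ : MeasureTheory.Measure (NashWelfare.Edge N M → ℝ))
    (hμ : NashWelfare.IsRoundingLaw (NashWelfare.xStar y κ) μ)
    (i : N) (L : List (Finset M)) (hL : NashWelfare.IsSortedConfigs (v i) (y i) (κ i) L)
    (lam : ℝ) (hlam : 0 ≤ lam) :
    MeasurableSet (NashWelfare.badSet (v i) (y i) (κ i) L μ i lam) ∧
      MeasureTheory.volume (NashWelfare.badSet (v i) (y i) (κ i) L μ i lam) ≤
        ENNReal.ofReal ((6 * lam + 1) * Real.exp (-lam)) := by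
  classical
  have huniv := hμ.measure_univ
  refine ⟨NashWelfare.measurableSet_badSet (hv i).nonneg _ _ _ huniv i lam, ?_⟩
  rcases le_total lam (5 / 2) with hle | hge
  · calc MeasureTheory.volume (NashWelfare.badSet (v i) (y i) (κ i) L μ i lam)
        ≤ MeasureTheory.volume (Set.Icc (0 : ℝ) 1) := MeasureTheory.measure_mono fun t ht => ht.1
      _ = ENNReal.ofReal 1 := by rw [Real.volume_Icc, sub_zero]
      _ ≤ _ := by
        refine ENNReal.ofReal_le_ofReal ?_
        rw [Real.exp_neg, ← div_eq_mul_inv, one_le_div (Real.exp_pos lam)]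
        exact NashWelfare.exp_le_six_mul_add_one hlam hle
  set s := 1 - Real.exp (-lam) with hs
  have hs1 : s ≤ 1 := by linarith [Real.exp_pos (-lam)]
  set c := NashWelfare.outputQuantilePos (v i) μ i s with hc
  set P : Finset M → Prop := fun S =>
    Real.exp lam * (v i {κ i S} + c) < v i (S.erase (κ i S)) with hP
  -- Replacing `C_t` by the smaller `C_s` makes badness for `0 < t ≤ s` a property of the
  -- configuration alone. The piece `(s, 1]` accounts for the `+ 1` in the bound.
  have hsub : NashWelfare.badSet (v i) (y i) (κ i) L μ i lam ⊆ ({0} ∪ Set.Ioc s 1) ∪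
      {t | 0 < t ∧ t ≤ (L.map (y i)).sum ∧ P (NashWelfare.configAt (y i) L t)} := by
    rintro t ⟨⟨h0, h1⟩, hbad⟩
    rcases h0.eq_or_lt with h0 | h0
    · exact Or.inl (Or.inl h0.symm)
    rcases lt_or_ge s t with hst | hts
    · exact Or.inl (Or.inr ⟨hst, h1⟩)
    refine Or.inr ⟨h0, ?_, ?_⟩
    · rwa [hL.sum_eq_one (hy.nonneg i) (hy.agent i)]
    · have hq := NashWelfare.outputQuantilePos_anti (hv i).nonneg huniv i h0 hts hs1
      have hq0 := NashWelfare.outputQuantilePos_nonneg (hv i).nonneg huniv i h0 h1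
      rw [NashWelfare.outputQuantile, if_neg h0.ne'] at hbad
      refine lt_of_le_of_lt ?_ (NashWelfare.exp_mul_lt_of_ln_lt
        (add_nonneg ((hv i).nonneg _) hq0) hbad)
      exact mul_le_mul_of_nonneg_left (add_le_add_right hq _) (Real.exp_pos lam).le
  have hsum := NashWelfare.sum_badConfigs_le (hv i) (hy.nonneg i) (hy.agent i) hκ hμ hge
    {S | 0 < y i S ∧ P S} fun S hS => by simpa using hS
  have hvol := NashWelfare.volume_configAt_le (hy.nonneg i) P L
  rw [hL.sum_filter] at hvol
  have hIoc : MeasureTheory.volume (Set.Ioc s 1) = ENNReal.ofReal (Real.exp (-lam)) := by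
    rw [Real.volume_Ioc, hs, sub_sub_cancel]
  calc MeasureTheory.volume (NashWelfare.badSet (v i) (y i) (κ i) L μ i lam)
      ≤ (MeasureTheory.volume {(0 : ℝ)} + MeasureTheory.volume (Set.Ioc s 1))
        + ENNReal.ofReal (∑ S with 0 < y i S ∧ P S, y i S) :=
        (MeasureTheory.measure_mono hsub).trans ((MeasureTheory.measure_union_le _ _).trans
          (add_le_add (MeasureTheory.measure_union_le _ _) hvol))
    _ ≤ ENNReal.ofReal (Real.exp (-lam)) + ENNReal.ofReal (6 * lam * Real.exp (-lam)) := by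
        rw [Real.volume_singleton, zero_add, hIoc]
        exact add_le_add_right (ENNReal.ofReal_le_ofReal hsum) _
    _ = _ := by
        rw [← ENNReal.ofReal_add (by positivity) (by positivity)]
        congr 1
        ring
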